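/- **Setting.** For germs of holomorphic functions $F(z)=\sum_{n\ge0} a_nz^n$ and $G(z)=\sum_{n\ge0} b_nz^n$ at $0$, let $F\odot G(z)=\sum_{n\ge 0} a_nb_nz^n$ be their Hadamard product. Let $\varepsilon\in\{1,-1\}$ and $K_0(z)=\varepsilon\,\frac{z}{(1-z)^2}=\varepsilon\sum_{n\ge1}nz^n$ be the Koebe function (the usual normalization is $\varepsilon=1$; the normalization $K_0=-\sum_{n\ge1} nz^n$ is $\varepsilon=-1$). A germ $g$ at a point $w\neq\beta$ (a branch of an analytic function) *has an isolated singularity or a regular point at $\beta\in\mathbb C$* if it continues analytically in a pointed disc $0<|z-\beta|<r$ containing $w$, around $\beta$, in a sector of angle more than $2\pi$ (on the universal covering of the pointed disc) that contains $w$ and its full positive turn around $\beta$. Its *monodromy* at $\beta$ is the germ $\Delta_\beta g=g_+-g$ at $w$, where $g_+$ is the analytic continuation of $g$ once around $\beta$ in the positive direction. A germ at $w$ is called *holomorphic at $\beta$* if it extends holomorphically to a disc centred at $\beta$ that contains $w$. **Proposition.** Let $G$ be a germ of holomorphic function at $0$ that continues analytically along a path $\gamma$ starting at $0$ and ending at $w$,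 and let $g$ be the resulting germ at $w$. Then $-K_0\odot G$ continues analytically along $\gamma$. Let $k$ be the resulting germ at $w$, and let $\beta\in\mathbb C$. 1. If $g$ is holomorphic at $\beta$, then so is $k$. 2. If $g$ has an isolated singularity or a regular point at $\beta$, then so has $k$, the monodromies $\Delta_\beta g$ and $\Delta_\beta k$ exist, and $$\Delta_\beta k\,(z)=-\varepsilon\, z\,(\Delta_\beta g)'(z)$$ for all $z$ near $w$. That is, $$\Delta_\beta(-K_0\odot G)=-\varepsilon\, z\,(\Delta_\beta G)' ,$$ which is $z\,(\Delta_\beta G)'$ for $K_0=-\frac{z}{(1-z)^2}$: up to the sign fixed by the normalization of $K_0$, the monodromies of the Hadamard product with $-K_0$ are the derivatives $z\frac{d}{dz}$ of the monodromies of $G$. If moreover $\Delta_\beta g$ is holomorphic at $\beta$, then so is $\Delta_\beta k$. -/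

import Mathlib

open Filter Topology unitInterval

/-- The `n`-th Taylor coefficient at `0` of a germ of holomorphic function at `0`. -/
noncomputable def taylorCoeff (f : ℂ → ℂ) (n : ℕ) : ℂ :=
  iteratedDeriv n f 0 / (n.factorial : ℂ)

/-- The Hadamard product `∑ aₙ bₙ zⁿ` of two germs `∑ aₙ zⁿ`, `∑ bₙ zⁿ` at `0`.
Only its germ at `0` is meaningful. -/
noncomputable def hadamardProduct (f g : ℂ → ℂ) : ℂ → ℂ :=
  fun z => ∑' n : ℕ, taylorCoeff f n * taylorCoeff g n * z ^ n

/-- The Koebe function, `z / (1 - z)²` for `ε = 1` (the usual normalization), and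
`-z / (1 - z)² = -∑ n zⁿ` for `ε = -1`. -/
noncomputable def koebe (ε : ℤˣ) (z : ℂ) : ℂ :=
  ((ε : ℤ) : ℂ) * (z / (1 - z) ^ 2)

/-- Weierstrass analytic continuation along the path `γ`: the germ of `f` at `γ 0` continues along
`γ` to the germ of `g` at `γ 1`. Here `φ t` represents the germ at `γ t`. -/
def ContinuesAlong (γ : C(I, ℂ)) (f g : ℂ → ℂ) : Prop :=
  ∃ φ : I → ℂ → ℂ,
    (∀ t, AnalyticAt ℂ (φ t) (γ t)) ∧
    (∀ t, ∀ᶠ s in 𝓝 t, φ s =ᶠ[𝓝 (γ s)] φ t) ∧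
    φ 0 =ᶠ[𝓝 (γ 0)] f ∧ φ 1 =ᶠ[𝓝 (γ 1)] g

/-- The circle centred at `β`, from `w` to `w`, run once in the positive direction. -/
noncomputable def circleLoop (β w : ℂ) : C(I, ℂ) where
  toFun t := β + (w - β) * Complex.exp (2 * Real.pi * ((t : ℝ) : ℂ) * Complex.I)
  continuous_toFun := by fun_prop

/-- The image under `ζ ↦ β + exp ζ` of a path `η`. In the coordinate `ζ = log (z - β)`, a pointed
disc centred at `β` unfolds to a half plane `Re ζ < log r`, and `Im ζ` is the angle around `β`. -/
noncomputable def aroundPath (β : ℂ) (η : C(I, ℂ)) : C(I, ℂ) where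
  toFun t := β + Complex.exp (η t)
  continuous_toFun := by fun_prop

/-- The germ `g` at `w` has at the point `β` an isolated singularity (or a regular point): in a
pointed disc `0 < |z - β| < r` containing `w`, it continues analytically around `β`, in a sector
`θ₀ < arg (z - β) < θ₁` (on the universal covering of the pointed disc) that contains `w` together
with its positive turn around `β`; in particular the sector has an angle of more than `2π`. -/
def IsIsolatedAt (β w : ℂ) (g : ℂ → ℂ) : Prop :=
  AnalyticAt ℂ g w ∧
  ∃ (r θ₀ θ₁ : ℝ) (ζ₀ : ℂ), β + Complex.exp ζ₀ = w ∧ Real.exp ζ₀.re < r ∧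
    θ₀ < ζ₀.im ∧ ζ₀.im + 2 * Real.pi < θ₁ ∧
    ∀ η : C(I, ℂ), η 0 = ζ₀ →
      (∀ t, Real.exp (η t).re < r ∧ θ₀ < (η t).im ∧ (η t).im < θ₁) →
      ∃ g₁, ContinuesAlong (aroundPath β η) g g₁

/-- The germ `g` at `w` extends holomorphically to a disc centred at `β` that contains `w`. -/
def IsRegularAt (β w : ℂ) (g : ℂ → ℂ) : Prop :=
  ∃ ρ : ℝ, dist w β < ρ ∧ ∃ h, AnalyticOnNhd ℂ h (Metric.ball β ρ) ∧ h =ᶠ[𝓝 w] g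

/-- The germ of `D` at `w` is the monodromy `Δ_β g = g₊ - g` of the germ `g` at `w`, where `g₊` is
the analytic continuation of `g` once around `β` in the positive direction. -/
def IsMonodromy (β w : ℂ) (g D : ℂ → ℂ) : Prop :=
  ∃ gp : ℂ → ℂ, ContinuesAlong (circleLoop β w) g gp ∧ D =ᶠ[𝓝 w] fun z => gp z - g z

/-- The monodromy at `β` of the germ `g` at `w` is holomorphic at `β`: it extends holomorphically
to a disc centred at `β` that contains `w`. -/
def HasHolomorphicMonodromy (β w : ℂ) (g : ℂ → ℂ) : Prop :=
  ∃ D, IsMonodromy β w g D ∧ IsRegularAt β w D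

/-! The Taylor coefficients of `-K₀` are `-ε n`, so near `0` the Hadamard product with `-K₀` is the
Euler operator `-ε z d/dz` (`hadamardProduct_neg_koebe`). This operator is local, linear and
preserves analyticity, hence it commutes with continuation along any path
(`ContinuesAlong.eulerOp`). By uniqueness of continuation (`ContinuesAlong.unique`), `k` is the germ
`-ε z g'`. Regularity and isolated singularities then pass from `g` to `k`, and linearity carries
the operator through the difference `g₊ - g`. -/

/-- The operator `f ↦ c z f'(z)`. -/
noncomputable def eulerOp (c : ℂ) (f : ℂ → ℂ) : ℂ → ℂ :=
  fun z => c * (z * deriv f z)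

theorem AnalyticAt.eulerOp {c : ℂ} {f : ℂ → ℂ} {z : ℂ} (hf : AnalyticAt ℂ f z) :
    AnalyticAt ℂ (eulerOp c f) z :=
  analyticAt_const.mul (analyticAt_id.mul hf.deriv)

theorem eulerOp_congr (c : ℂ) {f g : ℂ → ℂ} {z : ℂ} (h : f =ᶠ[𝓝 z] g) :
    eulerOp c f =ᶠ[𝓝 z] eulerOp c g := by
  filter_upwards [h.deriv] with x hx
  simp only [eulerOp, hx]

theorem eulerOp_sub (c : ℂ) {f g : ℂ → ℂ} {z : ℂ} (hf : AnalyticAt ℂ f z)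
    (hg : AnalyticAt ℂ g z) :
    eulerOp c (fun x => f x - g x) =ᶠ[𝓝 z] fun x => eulerOp c f x - eulerOp c g x := by
  filter_upwards [hf.eventually_analyticAt, hg.eventually_analyticAt] with x hfx hgx
  simp only [eulerOp, deriv_fun_sub hfx.differentiableAt hgx.differentiableAt]
  ring

theorem AnalyticAt.eventually_hasSum_taylorCoeff {f : ℂ → ℂ} (hf : AnalyticAt ℂ f 0) :
    ∀ᶠ z in 𝓝 (0 : ℂ), HasSum (fun n => taylorCoeff f n * z ^ n) (f z) := by
  have h := hasFPowerSeriesAt_iff.1 hf.hasFPowerSeriesAt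
  filter_upwards [h] with z hz
  simpa [taylorCoeff, mul_comm, FormalMultilinearSeries.coeff_ofScalars] using hz

theorem taylorCoeff_eq_of_hasSum {f : ℂ → ℂ} {a : ℕ → ℂ}
    (h : ∀ᶠ z in 𝓝 (0 : ℂ), HasSum (fun n => a n * z ^ n) (f z)) (n : ℕ) :
    taylorCoeff f n = a n := by
  have h1 : HasFPowerSeriesAt f (FormalMultilinearSeries.ofScalars ℂ a) 0 := by
    rw [hasFPowerSeriesAt_iff]
    filter_upwards [h] with z hz
    simpa [mul_comm, FormalMultilinearSeries.coeff_ofScalars] using hz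
  have h2 := h1.analyticAt.hasFPowerSeriesAt.eq_formalMultilinearSeries h1
  have h3 := congrArg (fun p => FormalMultilinearSeries.coeff p n) h2
  simpa [taylorCoeff, FormalMultilinearSeries.coeff_ofScalars] using h3

theorem taylorCoeff_neg_koebe (ε : ℤˣ) (n : ℕ) :
    taylorCoeff (fun z => -koebe ε z) n = -((ε : ℤ) : ℂ) * n := by
  refine taylorCoeff_eq_of_hasSum (a := fun n : ℕ => -((ε : ℤ) : ℂ) * n) ?_ n
  filter_upwards [Metric.ball_mem_nhds (0 : ℂ) one_pos] with z hz
  have hz : ‖z‖ < 1 := by simpa using hz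
  have := (hasSum_coe_mul_geometric_of_norm_lt_one hz).mul_left (-((ε : ℤ) : ℂ))
  simpa only [koebe, neg_mul, mul_assoc] using this

theorem hadamardProduct_neg_koebe (ε : ℤˣ) {G : ℂ → ℂ} (hG : AnalyticAt ℂ G 0) :
    hadamardProduct (fun z => -koebe ε z) G =ᶠ[𝓝 0] eulerOp (-((ε : ℤ) : ℂ)) G := by
  filter_upwards [hG.deriv.eventually_hasSum_taylorCoeff] with z hz
  have key : HasSum (fun n : ℕ => (n : ℂ) * taylorCoeff G n * z ^ n) (z * deriv G z) := by
    have h1 := hz.mul_left z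
    -- The term `n = 0` vanishes. After the shift, `(n + 1) aₙ₊₁` is the `n`-th Taylor coefficient
    -- of `G'`, so no termwise differentiation is needed.
    rw [← hasSum_nat_add_iff' 1]
    simp only [Finset.range_one, Finset.sum_singleton, Nat.cast_zero, zero_mul, sub_zero]
    refine h1.congr_fun fun n => ?_
    have hn : ((n : ℂ) + 1) ≠ 0 := by exact_mod_cast n.succ_ne_zero
    have hf : (n.factorial : ℂ) ≠ 0 := by exact_mod_cast n.factorial_ne_zero
    simp only [taylorCoeff, ← iteratedDeriv_succ', Nat.factorial_succ]
    push_cast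
    field_simp
    ring
  have := (key.mul_left (-((ε : ℤ) : ℂ))).tsum_eq
  simp only [hadamardProduct, taylorCoeff_neg_koebe, eulerOp, ← this, mul_assoc]

namespace ContinuesAlong

variable {γ : C(I, ℂ)} {f f' g g' : ℂ → ℂ}

theorem congr_left (h : ContinuesAlong γ f g) (hf : f =ᶠ[𝓝 (γ 0)] f') :
    ContinuesAlong γ f' g := by
  obtain ⟨φ, h1, h2, h3, h4⟩ := h
  exact ⟨φ, h1, h2, h3.trans hf, h4⟩

theorem congr_right (h : ContinuesAlong γ f g) (hg : g =ᶠ[𝓝 (γ 1)] g') :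
    ContinuesAlong γ f g' := by
  obtain ⟨φ, h1, h2, h3, h4⟩ := h
  exact ⟨φ, h1, h2, h3, h4.trans hg⟩

theorem analyticAt_right (h : ContinuesAlong γ f g) : AnalyticAt ℂ g (γ 1) := by
  obtain ⟨φ, h1, -, -, h4⟩ := h
  exact (h1 1).congr h4

/-- Locality of the operator: applied to each germ of the family, it preserves the agreement of
neighbouring germs. -/
theorem eulerOp (c : ℂ) (h : ContinuesAlong γ f g) :
    ContinuesAlong γ (eulerOp c f) (eulerOp c g) := by
  obtain ⟨φ, h1, h2, h3, h4⟩ := h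
  exact ⟨fun t => _root_.eulerOp c (φ t), fun t => (h1 t).eulerOp,
    fun t => (h2 t).mono fun s hs => eulerOp_congr c hs,
    eulerOp_congr c h3, eulerOp_congr c h4⟩

/-- By the identity theorem on small discs, the parameters at which two continuations agree form a
clopen set. It contains `0`, and the interval is connected. -/
theorem unique (h : ContinuesAlong γ f g) (h' : ContinuesAlong γ f g') :
    g =ᶠ[𝓝 (γ 1)] g' := by
  obtain ⟨φ, a, l, i, e⟩ := h
  obtain ⟨ψ, a', l', i', e'⟩ := h'
  -- Near `t`, the germs at `γ s` agree if and only if those at `γ t` do.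
  have key : ∀ t, ∀ᶠ s in 𝓝 t, (φ s =ᶠ[𝓝 (γ s)] ψ s ↔ φ t =ᶠ[𝓝 (γ t)] ψ t) := by
    intro t
    obtain ⟨r, hr, hb⟩ := Metric.eventually_nhds_iff_ball.1
      ((a t).eventually_analyticAt.and (a' t).eventually_analyticAt)
    have hγt : ∀ᶠ s in 𝓝 t, γ s ∈ Metric.ball (γ t) r :=
      γ.continuous.continuousAt (Metric.ball_mem_nhds _ hr)
    filter_upwards [l t, l' t, hγt] with s h1 h2 h3
    have p : IsPreconnected (Metric.ball (γ t) r) := (convex_ball _ _).isPreconnected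
    have u : AnalyticOnNhd ℂ (φ t) (Metric.ball (γ t) r) := fun x hx => (hb x hx).1
    have v : AnalyticOnNhd ℂ (ψ t) (Metric.ball (γ t) r) := fun x hx => (hb x hx).2
    constructor
    · intro h
      exact (u.eqOn_of_preconnected_of_eventuallyEq v p h3 ((h1.symm.trans h).trans h2)).eventuallyEq_of_mem
        (Metric.ball_mem_nhds _ hr)
    · intro h
      exact (h1.trans ((u.eqOn_of_preconnected_of_eventuallyEq v p
        (Metric.mem_ball_self hr) h).eventuallyEq_of_mem (Metric.isOpen_ball.mem_nhds h3))).trans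
          h2.symm
  have hc : IsClopen {t | φ t =ᶠ[𝓝 (γ t)] ψ t} := by
    refine ⟨⟨isOpen_iff_mem_nhds.2 fun t ht => ?_⟩, isOpen_iff_mem_nhds.2 fun t ht => ?_⟩
    · filter_upwards [key t] with s hs using fun h => ht (hs.1 h)
    · filter_upwards [key t] with s hs using hs.2 ht
  have h1 : (1 : I) ∈ {t | φ t =ᶠ[𝓝 (γ t)] ψ t} := by
    rw [hc.eq_univ ⟨0, i.trans i'.symm⟩]
    trivial
  exact (e.symm.trans h1).trans e'

end ContinuesAlong

@[simp] theorem circleLoop_zero (β w : ℂ) : circleLoop β w 0 = w := by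
  simp [circleLoop]

@[simp] theorem circleLoop_one (β w : ℂ) : circleLoop β w 1 = w := by
  simp [circleLoop, Complex.exp_two_pi_mul_I]

section Singularities

variable {β w : ℂ} {g k D E : ℂ → ℂ}

theorem IsRegularAt.congr (h : IsRegularAt β w g) (hk : k =ᶠ[𝓝 w] g) : IsRegularAt β w k := by
  obtain ⟨ρ, hρ, h, ha, he⟩ := h
  exact ⟨ρ, hρ, h, ha, he.trans hk.symm⟩

theorem IsRegularAt.eulerOp (c : ℂ) (h : IsRegularAt β w g) :
    IsRegularAt β w (eulerOp c g) := by
  obtain ⟨ρ, hρ, h, ha, he⟩ := h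
  exact ⟨ρ, hρ, _, fun z hz => (ha z hz).eulerOp, eulerOp_congr c he⟩

theorem IsIsolatedAt.congr (h : IsIsolatedAt β w g) (hk : k =ᶠ[𝓝 w] g) :
    IsIsolatedAt β w k := by
  obtain ⟨ha, r, θ₀, θ₁, ζ₀, rfl, hr, h0, h1, H⟩ := h
  refine ⟨ha.congr hk.symm, r, θ₀, θ₁, ζ₀, rfl, hr, h0, h1, fun η hη hs => ?_⟩
  obtain ⟨g₁, hg₁⟩ := H η hη hs
  exact ⟨g₁, hg₁.congr_left (by simpa [aroundPath, hη] using hk.symm)⟩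

theorem IsIsolatedAt.eulerOp (c : ℂ) (h : IsIsolatedAt β w g) :
    IsIsolatedAt β w (eulerOp c g) := by
  obtain ⟨ha, r, θ₀, θ₁, ζ₀, hw, hr, h0, h1, H⟩ := h
  refine ⟨ha.eulerOp, r, θ₀, θ₁, ζ₀, hw, hr, h0, h1, fun η hη hs => ?_⟩
  obtain ⟨g₁, hg₁⟩ := H η hη hs
  exact ⟨_, hg₁.eulerOp c⟩

theorem IsIsolatedAt.exists_isMonodromy (h : IsIsolatedAt β w g) :
    ∃ D, IsMonodromy β w g D := by
  obtain ⟨ha, r, θ₀, θ₁, ζ₀, rfl, hr, h0, h1, H⟩ := h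
  -- In the logarithmic coordinate, the positive turn is a vertical segment of length `2π`; the
  -- sector contains both its ends, hence all of it.
  let η : C(I, ℂ) := ⟨fun t => ζ₀ + 2 * Real.pi * ((t : ℝ) : ℂ) * Complex.I, by fun_prop⟩
  have hloop : aroundPath β η = circleLoop β (β + Complex.exp ζ₀) := by
    ext t
    simp [aroundPath, circleLoop, η, Complex.exp_add]
  obtain ⟨g₁, hg₁⟩ := H η (by simp [η]) fun t => by
    have him : (η t).im = ζ₀.im + 2 * Real.pi * t := by simp [η]
    have hre : (η t).re = ζ₀.re := by simp [η]
    have ht0 : 0 ≤ (t : ℝ) := t.2.1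
    have ht1 : (t : ℝ) ≤ 1 := t.2.2
    have hπ := Real.pi_pos
    rw [him, hre]
    exact ⟨hr, by nlinarith, by nlinarith⟩
  exact ⟨_, g₁, hloop ▸ hg₁, EventuallyEq.rfl⟩

theorem IsMonodromy.unique (hD : IsMonodromy β w g D) (hE : IsMonodromy β w g E) :
    E =ᶠ[𝓝 w] D := by
  obtain ⟨p, hp, h1⟩ := hD
  obtain ⟨q, hq, h2⟩ := hE
  have h := hq.unique hp
  rw [circleLoop_one] at h
  exact (h2.trans (h.sub EventuallyEq.rfl)).trans h1.symm

theorem IsMonodromy.congr (hD : IsMonodromy β w g D) (hE : E =ᶠ[𝓝 w] D)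
    (hk : k =ᶠ[𝓝 w] g) : IsMonodromy β w k E := by
  obtain ⟨p, hp, h1⟩ := hD
  exact ⟨p, hp.congr_left (by simpa using hk.symm),
    (hE.trans h1).trans (EventuallyEq.rfl.sub hk.symm)⟩

/-- The loop closes up at `w`, so `g₊` and `g` are both analytic there and the derivative splits
over their difference. -/
theorem IsMonodromy.eulerOp (c : ℂ) (hg : AnalyticAt ℂ g w) (hD : IsMonodromy β w g D) :
    IsMonodromy β w (eulerOp c g) (eulerOp c D) := by
  obtain ⟨p, hp, h1⟩ := hD
  have ha := hp.analyticAt_right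
  rw [circleLoop_one] at ha
  exact ⟨_, hp.eulerOp c, (eulerOp_congr c h1).trans (eulerOp_sub c ha hg)⟩

end Singularities

theorem mainTheorem11 (ε : ℤˣ) (G : ℂ → ℂ) (hG : AnalyticAt ℂ G 0)
    (γ : C(I, ℂ)) (hγ : γ 0 = 0) (g : ℂ → ℂ) (hg : ContinuesAlong γ G g) :
    (∃ k, ContinuesAlong γ (hadamardProduct (fun z => -koebe ε z) G) k) ∧
    ∀ k, ContinuesAlong γ (hadamardProduct (fun z => -koebe ε z) G) k →
      ∀ β : ℂ,
        (IsRegularAt β (γ 1) g → IsRegularAt β (γ 1) k) ∧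
        (IsIsolatedAt β (γ 1) g →
          IsIsolatedAt β (γ 1) k ∧
          (∃ D, IsMonodromy β (γ 1) g D) ∧
          (∀ D, IsMonodromy β (γ 1) g D → ∀ E, IsMonodromy β (γ 1) k E ↔
            E =ᶠ[𝓝 (γ 1)] fun z => -((ε : ℤ) : ℂ) * (z * deriv D z)) ∧
          (HasHolomorphicMonodromy β (γ 1) g → HasHolomorphicMonodromy β (γ 1) k)) := by
  have hT := hadamardProduct_neg_koebe ε hG
  rw [← hγ] at hT
  have hc := (hg.eulerOp (-((ε : ℤ) : ℂ))).congr_left hT.symm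
  refine ⟨⟨_, hc⟩, fun k hk β => ?_⟩
  -- The germ `k` is arbitrary among the continuations; uniqueness reduces it to the Euler operator
  -- applied to `g`.
  have hkg := hk.unique hc
  refine ⟨fun h => (h.eulerOp _).congr hkg, fun h => ?_⟩
  have hmono : ∀ D, IsMonodromy β (γ 1) g D →
      IsMonodromy β (γ 1) k (eulerOp (-((ε : ℤ) : ℂ)) D) := fun D hD =>
    (hD.eulerOp _ hg.analyticAt_right).congr EventuallyEq.rfl hkg
  refine ⟨(h.eulerOp _).congr hkg, h.exists_isMonodromy, fun D hD E => ⟨(hmono D hD).unique,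
    fun hE => (hmono D hD).congr hE EventuallyEq.rfl⟩, ?_⟩
  rintro ⟨D, hD, hr⟩
  exact ⟨_, hmono D hD, hr.eulerOp _⟩
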